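/- For a compact metric space $(Z,\rho)$ and a positive integer $n$, give $M_n(\mathbb C)$ the operator norm from the Euclidean norm of $\mathbb C^n$, give $M_n(C(Z))$ (continuous functions $Z\to M_n(\mathbb C)$) the supremum norm, and for $a: Z\to M_n(\mathbb C)$ put $$L(a)=L^\rho(a)=\sup\{\|a(x)-a(y)\|/\rho(x,y) : x,y\in Z,\ x\ne y\}\in[0,\infty].$$ Let $\mathcal P_n^r(Z)$ be the set of projections $p=p^2=p^*$ in $M_n(C(Z))$ with $L(p)<r$, with the topology of the supremum norm; a path in it is a continuous map on $[0,1]$. Let $\lambda_n$ be the infimum of the constants $c\ge 0$ with the following property: for every compact metric space $Z$, closed subset $X\subseteq Z$, compact space $T$, constant $N\ge 0$, and continuous function $F$ from $X\times T$ to the self-adjoint matrices in $M_n(\mathbb C)$ with $L(F_t)\le N$ for all $t\in T$ (where $F_t(x)=F(x,t)$), there is a continuous extension $G$ of $F$ to $Z\times T$ with self-adjoint values such that $L(G_t)\le cN$ for all $t$ and $\|G\|_\infty=\|F\|_\infty$. **Theorem 6.6.** Let $X$ and $Y$ be non-empty compact metric spaces, let $\rho$ be a metric on their disjoint union $X\,\dot\cup\,Y$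 that restricts to the given metrics on $X$ and $Y$, and let $n\ge 1$ be an integer and $r>0$. Suppose that the Hausdorff distance between $X$ and $Y$ for $\rho$ is less than $\varepsilon$ and that $\varepsilon\lambda_n r<1/12$, and put $s=\lambda_n r\,(1-12\varepsilon\lambda_n r)^{-1}$. Then for every path $p$ in $\mathcal P_n^r(X)$ there is a path $q$ in $\mathcal P_n^s(Y)$ such that $L^\rho(p_t\oplus q_t)<s$ for every $t\in[0,1]$, where $p_t\oplus q_t$ is the function on $X\,\dot\cup\,Y$ equal to $p_t$ on $X$ and to $q_t$ on $Y$. -/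

import Mathlib

open scoped ENNReal NNReal Matrix.Norms.L2Operator

noncomputable section

/-- The `n × n` complex matrices. With the scope `Matrix.Norms.L2Operator` open, the norm is the
operator norm for the Euclidean norm on `ℂⁿ`. The algebra `M_n(C(X))` is `C(X, Mat n)`, with the
supremum norm. -/
abbrev Mat (n : ℕ) : Type := Matrix (Fin n) (Fin n) ℂ

/-- The Lipschitz seminorm `L(a) = sup {‖a x - a y‖ / ρ(x, y) : x ≠ y}` of a matrix-valued
function on a metric space, possibly `∞`. -/
def lipSeminorm {Z : Type*} [MetricSpace Z] {n : ℕ} (a : Z → Mat n) : ℝ≥0∞ :=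
  ⨆ (x : Z) (y : Z) (_ : x ≠ y), ENNReal.ofReal (‖a x - a y‖ / dist x y)

/-- `𝒫_n(X)`: the projections in `M_n(C(X))` with finite Lipschitz seminorm. -/
def lipProjections (n : ℕ) (X : Type*) [MetricSpace X] : Set C(X, Mat n) :=
  {p | IsStarProjection p ∧ lipSeminorm (p : X → Mat n) < ∞}

/-- `𝒫_n^r(X)`: the members `p` of `𝒫_n(X)` with `L(p) < r`. For compact `X`, its topology as a
subspace of `C(X, Mat n)` is that of the supremum norm. -/
def lipProjectionsLT (n : ℕ) (r : ℝ) (X : Type*) [MetricSpace X] : Set C(X, Mat n) :=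
  {p | p ∈ lipProjections n X ∧ lipSeminorm (p : X → Mat n) < ENNReal.ofReal r}

/-- `c` is an extension constant for self-adjoint `n × n` matrices: for every compact metric space
`Z`, closed (that is, compact) subset `X` of `Z`, compact space `T`, and continuous self-adjoint
`F` on `X × T` with `L(F_t) ≤ N` for all `t`, there is a continuous self-adjoint extension `G`
of `F` to `Z × T` with `L(G_t) ≤ c N` for all `t` and `‖G‖ = ‖F‖` (supremum norms).

Every compact metric space is isometric to one in `Type`, and only the image of `T` in
`C(X, Mat n)`, a compact metric space, matters, so `Type` is large enough. -/
def IsExtensionConstant (n : ℕ) (c : ℝ≥0) : Prop :=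
  ∀ (Z : Type) [MetricSpace Z] [CompactSpace Z] (X : Set Z) [CompactSpace X]
    (T : Type) [TopologicalSpace T] [CompactSpace T]
    (F : C(X × T, Mat n)) (N : ℝ≥0),
    (∀ z, IsSelfAdjoint (F z)) →
    (∀ t, lipSeminorm (fun x : X => F (x, t)) ≤ N) →
    ∃ G : C(Z × T, Mat n),
      (∀ z, IsSelfAdjoint (G z)) ∧
      (∀ (x : X) (t : T), G ((x : Z), t) = F (x, t)) ∧
      (∀ t, lipSeminorm (fun z : Z => G (z, t)) ≤ ((c * N : ℝ≥0) : ℝ≥0∞)) ∧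
      ‖G‖ = ‖F‖

/-- The constant `λ_n`: the infimum of the extension constants. -/
def extLambda (n : ℕ) : ℝ≥0 := sInf {c : ℝ≥0 | IsExtensionConstant n c}

end

/-! The path is a single self-adjoint contraction on `X × [0,1]`. Extend it to `Z × [0,1]`, where
`Z` is the disjoint union, with Lipschitz constant `c r` for some `c` close to `λ_n`. Each point of
`Z` lies within `ε' < ε` of `X`, so each value of the extension lies within `δ = ε' c r` of a
projection. Its spectrum therefore clusters within `4δ` of `0` and `1`, and cutting at the gap gives
a projection. Pointwise cutting keeps continuity and the Lipschitz bound because spectral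
projections at such a gap move at most `1 / (1 - 8δ)` times as fast as the element
(`IsNearSpectralProjection.norm_sub_le`). This gives the constant `c r / (1 - 8δ)`, which is below
`s` for suitable `c`. The path `q` is the restriction to `Y`. -/

/-- `p` is a projection commuting with `a` up to which `a` is, in norm, within `η` of `1` on the
range of `p` and within `η` of `0` on its complement. -/
structure IsNearSpectralProjection {A : Type*} [NormedRing A] [StarRing A]
    (η : ℝ) (a p : A) : Prop where
  isStarProjection : IsStarProjection p
  norm_one_sub_mul_le : ‖(1 - a) * p‖ ≤ η
  norm_mul_one_sub_le : ‖a * (1 - p)‖ ≤ η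
  commute : Commute a p

/-! ### Projections and spectral gaps in a C⋆-algebra. -/

section CStarAlgebra

variable {A : Type*} [CStarAlgebra A]

/-- The distance of two projections is controlled by the two off-diagonal corners. -/
theorem IsStarProjection.norm_sub_le_of_corners {p q : A} (hp : IsStarProjection p)
    (hq : IsStarProjection q) {m : ℝ} (h₁ : ‖p * (1 - q)‖ ≤ m) (h₂ : ‖(1 - p) * q‖ ≤ m) :
    ‖p - q‖ ≤ m := by
  let _ := CStarAlgebra.spectralOrder A
  let _ := CStarAlgebra.spectralOrderedRing A
  have hm : 0 ≤ m := (norm_nonneg _).trans h₁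
  -- Since `u = e u`, conjugating `u u⋆ ≤ ‖u‖²` by `e` confines the bound to the corner of `e`.
  have corner : ∀ {e u : A}, IsStarProjection e → e * u = u → ‖u‖ ≤ m →
      u * star u ≤ (m ^ 2) • e := by
    intro e u he heu hu
    have h := CStarAlgebra.star_right_conjugate_le_norm_smul (a := e) (b := u * star u)
      (IsSelfAdjoint.mul_star_self u)
    have h1 : e * (u * star u) * star e = u * star u := by
      have : star u * star e = star u := by rw [← star_mul, heu]
      rw [← mul_assoc, heu, mul_assoc, this]
    rw [h1, he.isSelfAdjoint.star_eq, he.isIdempotentElem.eq, CStarRing.norm_self_mul_star] at h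
    exact h.trans (smul_le_smul_of_nonneg_right (by nlinarith [norm_nonneg u]) he.nonneg)
  have hpp := hp.isIdempotentElem.eq
  have hqq := hq.isIdempotentElem.eq
  have hu := corner (u := p * (1 - q)) hp (by rw [← mul_assoc, hpp]) h₁
  have hv := corner (u := (1 - p) * q) hp.one_sub
    (by rw [← mul_assoc, hp.one_sub.isIdempotentElem.eq]) h₂
  -- The cross terms vanish, so the two corners are bounded by `m² p` and `m² (1 - p)`, which add up
  -- to `m²` with no factor `2`.
  have hD : (p - q) * star (p - q) ≤ algebraMap ℝ A (m ^ 2) := by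
    have e : (p - q) * star (p - q) = p * (1 - q) * star (p * (1 - q)) +
        (1 - p) * q * star ((1 - p) * q) := by
      simp only [star_mul, star_sub, star_one, hp.isSelfAdjoint.star_eq, hq.isSelfAdjoint.star_eq]
      simp only [mul_sub, sub_mul, mul_one, one_mul, ← mul_assoc, hpp, hqq]
      simp only [mul_assoc, hqq]
      abel
    rw [e, Algebra.algebraMap_eq_smul_one]
    refine (add_le_add hu hv).trans_eq ?_
    rw [← smul_add, add_sub_cancel]
  have := (CStarAlgebra.norm_le_iff_le_algebraMap _ (sq_nonneg m) (mul_star_self_nonneg _)).2 hD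
  rw [CStarRing.norm_self_mul_star, ← sq] at this
  exact (sq_le_sq₀ (norm_nonneg _) hm).1 this

/-- Replacing `a` by `1` on `p` and `b` by `0` on `1 - q` turns `p (a - b) (1 - q)` into `p (1 -
q)`. Each replacement costs at most `η ‖p (1 - q)‖`, and both costs are absorbed on the left. -/
theorem IsNearSpectralProjection.norm_mul_one_sub_le_of_norm_sub_le {a b p q : A} {η d : ℝ}
    (hη : 2 * η < 1) (hp : IsNearSpectralProjection η a p) (hq : IsNearSpectralProjection η b q)
    (hd : ‖a - b‖ ≤ d) : ‖p * (1 - q)‖ ≤ d / (1 - 2 * η) := by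
  have hpp := hp.isStarProjection.isIdempotentElem.eq
  have hqq := hq.isStarProjection.one_sub.isIdempotentElem.eq
  have key : p * (1 - q) = p * (a - b) * (1 - q) + ((1 - a) * p) * (p * (1 - q)) +
      (p * (1 - q)) * (b * (1 - q)) := by
    have hb : (1 - q) * (b * (1 - q)) = b * (1 - q) := by
      have : (1 - q) * b = b * (1 - q) :=
        ((Commute.one_right b).sub_right hq.commute).eq.symm
      rw [← mul_assoc, this, mul_assoc, hqq]
    have ha : (1 - a) * p * (p * (1 - q)) = p * (1 - a) * (1 - q) := by
      have : (1 - a) * p = p * (1 - a) := ((Commute.one_left p).sub_left hp.commute).eq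
      rw [← mul_assoc, mul_assoc (1 - a), hpp, this]
    rw [ha, mul_assoc p (1 - q), hb]
    noncomm_ring
  have n1 : ‖p‖ ≤ 1 := hp.isStarProjection.norm_le
  have n2 : ‖1 - q‖ ≤ 1 := hq.isStarProjection.one_sub.norm_le
  have t1 : ‖p * (a - b) * (1 - q)‖ ≤ d :=
    calc _ ≤ ‖p‖ * ‖a - b‖ * ‖1 - q‖ := norm_mul₃_le
      _ ≤ 1 * ‖a - b‖ * 1 := by gcongr
      _ ≤ d := by linarith
  have t2 := (norm_mul_le ((1 - a) * p) (p * (1 - q))).trans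
    (mul_le_mul_of_nonneg_right hp.norm_one_sub_mul_le (norm_nonneg _))
  have t3 := (norm_mul_le (p * (1 - q)) (b * (1 - q))).trans
    (mul_le_mul_of_nonneg_left hq.norm_mul_one_sub_le (norm_nonneg _))
  have := norm_add₃_le (a := p * (a - b) * (1 - q)) (b := ((1 - a) * p) * (p * (1 - q)))
    (c := (p * (1 - q)) * (b * (1 - q)))
  rw [← key] at this
  rw [le_div_iff₀ (by linarith)]
  linarith

/-- Spectral projections on both sides of a spectral gap depend Lipschitz continuously on the
element. -/
theorem IsNearSpectralProjection.norm_sub_le {a b p q : A} {η : ℝ}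
    (hη : 2 * η < 1) (hp : IsNearSpectralProjection η a p) (hq : IsNearSpectralProjection η b q) :
    ‖p - q‖ ≤ ‖a - b‖ / (1 - 2 * η) := by
  refine hp.isStarProjection.norm_sub_le_of_corners hq.isStarProjection
    (hp.norm_mul_one_sub_le_of_norm_sub_le hη hq le_rfl) ?_
  have h := hq.norm_mul_one_sub_le_of_norm_sub_le hη hp (norm_sub_rev b a).le
  rw [← norm_star] at h
  simpa [hp.isStarProjection.isSelfAdjoint.star_eq, hq.isStarProjection.isSelfAdjoint.star_eq]
    using h

theorem IsStarProjection.isNearSpectralProjection_self {p : A} (hp : IsStarProjection p) {η : ℝ}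
    (hη : 0 ≤ η) : IsNearSpectralProjection η p p :=
  ⟨hp, by simpa [hp.one_sub_mul_self], by simpa [hp.mul_one_sub_self], Commute.refl p⟩

/-- A self-adjoint contraction close to a projection has a spectral projection at the gap. -/
theorem IsSelfAdjoint.exists_isNearSpectralProjection {a e : A} (ha : IsSelfAdjoint a)
    (ha1 : ‖a‖ ≤ 1) (he : IsStarProjection e) {δ : ℝ} (hδ : δ ≤ 1 / 12) (hae : ‖a - e‖ ≤ δ) :
    ∃ p : A, IsNearSpectralProjection (4 * δ) a p := by
  have hδ0 : 0 ≤ δ := (norm_nonneg _).trans hae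
  have hdef : ‖a * a - a‖ ≤ 2 * δ := by
    have key : a * a - a = a * (a - e) - (a - e) * (1 - e) := by
      have := he.isIdempotentElem.eq
      simp only [mul_sub, sub_mul, mul_one, this]
      abel
    rw [key]
    have n1 : ‖1 - e‖ ≤ 1 := he.one_sub.norm_le
    have t1 := norm_mul_le a (a - e)
    have t2 := norm_mul_le (a - e) (1 - e)
    have := norm_sub_le (a * (a - e)) ((a - e) * (1 - e))
    nlinarith [norm_nonneg (a - e), norm_nonneg a, norm_nonneg (1 - e)]
  have hspec : ∀ x ∈ spectrum ℝ a, |x * x - x| ≤ 2 * δ := by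
    intro x hx
    have e1 : a * a - a = cfc (fun x : ℝ => x * x - x) a := by
      rw [cfc_sub (fun x : ℝ => x * x) (fun x => x) a, cfc_mul (fun x : ℝ => x) (fun x => x) a,
        cfc_id' ℝ a]
    rw [e1] at hdef
    exact (norm_cfc_le_iff _ a (by positivity) (by fun_prop) ha).1 hdef x hx
  let f : ℝ → ℝ := fun x => max 0 (min 1 (3 * x - 1))
  have hf : Continuous f := by fun_prop
  -- One of `|x|`, `|1 - x|` is at least `1/2`, so the other is at most `4δ ≤ 1/3`. The ramp `f` is
  -- `0` up to `1/3` and `1` from `2/3` on, hence takes only these two values on the spectrum.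
  have hcase : ∀ x ∈ spectrum ℝ a, (f x = 0 ∧ |x| ≤ 4 * δ) ∨ (f x = 1 ∧ |1 - x| ≤ 4 * δ) := by
    intro x hx
    have h := abs_le.1 (hspec x hx)
    rcases le_total x (1 / 2) with h2 | h2
    · have hx1 : x ≤ 4 * δ := by nlinarith
      have hx2 : -(4 * δ) ≤ x := by nlinarith
      refine Or.inl ⟨max_eq_left ((min_le_right _ _).trans (by linarith)), abs_le.2 ⟨hx2, hx1⟩⟩
    · have hx1 : 1 - x ≤ 4 * δ := by nlinarith
      have hx2 : -(4 * δ) ≤ 1 - x := by nlinarith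
      refine Or.inr ⟨?_, abs_le.2 ⟨hx2, hx1⟩⟩
      simp only [f]
      rw [min_eq_left (by linarith), max_eq_right zero_le_one]
  refine ⟨cfc f a, ⟨?_, cfc_predicate f a⟩, ?_, ?_, ?_⟩
  · rw [IsIdempotentElem, ← cfc_mul f f a]
    refine cfc_congr fun x hx => ?_
    rcases hcase x hx with h | h <;> simp [h.1]
  · have : (1 - a) * cfc f a = cfc (fun x => (1 - x) * f x) a := by
      rw [cfc_mul (fun x : ℝ => 1 - x) f a, cfc_sub (fun _ : ℝ => 1) (fun x => x) a,
        cfc_id' ℝ a, cfc_const_one ℝ a]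
    rw [this]
    refine norm_cfc_le (by positivity) fun x hx => ?_
    rcases hcase x hx with h | h
    · simp [h.1, hδ0]
    · simpa [h.1] using h.2
  · have : a * (1 - cfc f a) = cfc (fun x => x * (1 - f x)) a := by
      rw [cfc_mul (fun x : ℝ => x) (fun x => 1 - f x) a, cfc_sub (fun _ : ℝ => 1) f a,
        cfc_id' ℝ a, cfc_const_one ℝ a]
    rw [this]
    refine norm_cfc_le (by positivity) fun x hx => ?_
    rcases hcase x hx with h | h
    · simpa [h.1] using h.2
    · simp [h.1, hδ0]
  · have h := cfc_commute_cfc id f a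
    rwa [cfc_id ℝ a] at h

end CStarAlgebra


/-! ### The Lipschitz seminorm and the lower bound for extension constants. -/

theorem lipSeminorm_le_ofReal_iff {Z : Type*} [MetricSpace Z] {n : ℕ} {a : Z → Mat n} {K : ℝ}
    (hK : 0 ≤ K) :
    lipSeminorm a ≤ ENNReal.ofReal K ↔ ∀ x y, ‖a x - a y‖ ≤ K * dist x y := by
  simp only [lipSeminorm, iSup_le_iff]
  refine forall₂_congr fun x y => ?_
  rw [ENNReal.ofReal_le_ofReal_iff hK]
  by_cases h : x = y
  · simp [h]
  · rw [div_le_iff₀ (dist_pos.2 h)]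
    simp [h]

theorem lipSeminorm_le_coe_iff {Z : Type*} [MetricSpace Z] {n : ℕ} {a : Z → Mat n} {K : ℝ≥0} :
    lipSeminorm a ≤ K ↔ ∀ x y, ‖a x - a y‖ ≤ K * dist x y := by
  rw [← ENNReal.ofReal_coe_nnreal]
  exact lipSeminorm_le_ofReal_iff K.2

/-- Nothing can be gained when `X = Z`: a scalar function of Lipschitz constant `1` on two points is
its own only extension. -/
theorem IsExtensionConstant.one_le {n : ℕ} (hn : 0 < n) {c : ℝ≥0}
    (hc : IsExtensionConstant n c) : 1 ≤ c := by
  have : Nonempty (Fin n) := ⟨⟨0, hn⟩⟩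
  let Z : Set ℝ := {0, 1}
  have : CompactSpace Z := isCompact_iff_compactSpace.1 (Set.toFinite _).isCompact
  have : CompactSpace (Set.univ : Set Z) := isCompact_iff_compactSpace.1 isCompact_univ
  let F : C(↥(Set.univ : Set Z) × Unit, Mat n) :=
    ⟨fun z => ((z.1 : ℝ) : ℂ) • (1 : Mat n), by fun_prop⟩
  obtain ⟨G, -, hGF, hG, -⟩ := hc Z Set.univ Unit F 1
    (fun z => by
      simp only [F, ContinuousMap.coe_mk, IsSelfAdjoint, star_smul, star_one]
      simp)
    (fun t => lipSeminorm_le_coe_iff.2 fun x y => by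
      simp only [F, ContinuousMap.coe_mk]
      rw [← sub_smul, norm_smul, norm_one, mul_one, ← Complex.ofReal_sub, Complex.norm_real]
      simp [Subtype.dist_eq, Real.dist_eq])
  let z0 : Z := ⟨0, by simp [Z]⟩
  let z1 : Z := ⟨1, by simp [Z]⟩
  have h := lipSeminorm_le_coe_iff.1 (hG ()) z1 z0
  have h1 := hGF ⟨z1, trivial⟩ ()
  have h0 := hGF ⟨z0, trivial⟩ ()
  simp only at h1 h0 h
  rw [h1, h0] at h
  simpa [F, z0, z1, Subtype.dist_eq, Real.dist_eq] using h

/-! ### Finiteness of `λ_n`. -/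

section Retraction

variable {E : Type*} [NormedAddCommGroup E] [NormedSpace ℝ E]

/-- The radial retraction of a normed space onto the closed ball of radius `R` about `0`. -/
noncomputable def radialRetraction (R : ℝ) (a : E) : E := (R / max R ‖a‖) • a

theorem norm_radialRetraction_le {R : ℝ} (hR : 0 ≤ R) (a : E) : ‖radialRetraction R a‖ ≤ R := by
  have hm : 0 ≤ max R ‖a‖ := le_max_of_le_left hR
  rw [radialRetraction, norm_smul, Real.norm_of_nonneg (div_nonneg hR hm), div_mul_eq_mul_div]
  exact div_le_of_le_mul₀ hm hR (mul_le_mul_of_nonneg_left (le_max_right _ _) hR)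

theorem radialRetraction_of_norm_le {R : ℝ} {a : E} (ha : ‖a‖ ≤ R) :
    radialRetraction R a = a := by
  rw [radialRetraction, max_eq_left ha]
  rcases eq_or_ne R 0 with h | h
  · have : a = 0 := norm_le_zero_iff.1 (h ▸ ha)
    simp [this]
  · rw [div_self h, one_smul]

theorem norm_radialRetraction_sub_le {R : ℝ} (hR : 0 ≤ R) (a b : E) :
    ‖radialRetraction R a - radialRetraction R b‖ ≤ 2 * ‖a - b‖ := by
  rcases hR.eq_or_lt with rfl | hR
  · simp [radialRetraction]
  simp only [radialRetraction]
  set m := max R ‖a‖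
  set k := max R ‖b‖
  have hm : 0 < m := lt_max_of_lt_left hR
  have hk : 0 < k := lt_max_of_lt_left hR
  have e : (R / m) • a - (R / k) • b = (R / m) • (a - b) + (R * (k - m) / (m * k)) • b := by
    have : R / k = R / m - R * (k - m) / (m * k) := by field_simp; ring
    rw [this, smul_sub, sub_smul]
    abel
  have hmk : |k - m| ≤ ‖a - b‖ := by
    refine (abs_max_sub_max_le_max R ‖b‖ R ‖a‖).trans ?_
    rw [sub_self, abs_zero, max_eq_right (abs_nonneg _), norm_sub_rev]
    exact abs_norm_sub_norm_le b a
  rw [e]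
  refine (norm_add_le _ _).trans ?_
  have t1 : ‖(R / m) • (a - b)‖ ≤ ‖a - b‖ := by
    rw [norm_smul, Real.norm_of_nonneg (by positivity)]
    exact mul_le_of_le_one_left (norm_nonneg _) (div_le_one_of_le₀ (le_max_left _ _) hm.le)
  have t2 : ‖(R * (k - m) / (m * k)) • b‖ ≤ ‖a - b‖ := by
    rw [norm_smul, Real.norm_eq_abs, abs_div, abs_mul, abs_of_pos hR, abs_of_pos (mul_pos hm hk),
      div_mul_eq_mul_div, div_le_iff₀ (mul_pos hm hk)]
    have h1 : R ≤ m := le_max_left _ _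
    have h2 : ‖b‖ ≤ k := le_max_right _ _
    calc R * |k - m| * ‖b‖ ≤ m * ‖a - b‖ * k := by gcongr
      _ = ‖a - b‖ * (m * k) := by ring
  linarith

end Retraction

/-- McShane extension of a continuous family of Lipschitz functions to a jointly continuous
family. -/
theorem exists_jointly_lipschitz_extension {X Z T : Type*} [MetricSpace Z] [TopologicalSpace X]
    [CompactSpace X] [TopologicalSpace T] (i : X → Z) (f : C(X × T, ℝ)) {N : ℝ} (hN : 0 ≤ N)
    (hf : ∀ t x y, |f (x, t) - f (y, t)| ≤ N * dist (i x) (i y)) :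
    ∃ g : C(Z × T, ℝ), (∀ x t, g (i x, t) = f (x, t)) ∧
      ∀ t z w, |g (z, t) - g (w, t)| ≤ N * dist z w := by
  rcases isEmpty_or_nonempty X with hX | hX
  · exact ⟨0, fun x => isEmptyElim x, fun t z w => by
      simpa using mul_nonneg hN dist_nonneg⟩
  -- Compactness of `X` makes the family continuous in `t` for the supremum norm, which yields joint
  -- continuity of the infimum.
  let φ : C(T, C(X, ℝ)) := (f.comp ContinuousMap.prodSwap).curry
  have hφ : ∀ t x, φ t x = f (x, t) := fun t x => rfl
  let g : Z × T → ℝ := fun z => ⨅ x, (f (x, z.2) + N * dist z.1 (i x))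
  have hbdd : ∀ z t, BddBelow (Set.range fun x => f (x, t) + N * dist z (i x)) := by
    intro z t
    refine ⟨-‖φ t‖, ?_⟩
    rintro _ ⟨x, rfl⟩
    have h1 := (abs_le.1 ((φ t).norm_coe_le_norm x)).1
    have := mul_nonneg hN (dist_nonneg (x := z) (y := i x))
    rw [hφ] at h1
    simp only
    linarith
  have hle : ∀ z w t u, g (z, t) ≤ g (w, u) + (N * dist z w + ‖φ t - φ u‖) := by
    intro z w t u
    rw [← sub_le_iff_le_add]
    refine le_ciInf fun x => ?_
    have h1 : g (z, t) ≤ f (x, t) + N * dist z (i x) := ciInf_le (hbdd z t) x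
    have h2 := (abs_le.1 ((φ t - φ u).norm_coe_le_norm x)).2
    simp only [ContinuousMap.sub_apply, hφ] at h2
    have h3 := mul_le_mul_of_nonneg_left (dist_triangle z w (i x)) hN
    simp only
    linarith
  have habs : ∀ z w t u, |g (z, t) - g (w, u)| ≤ N * dist z w + ‖φ t - φ u‖ := by
    intro z w t u
    have h1 := hle z w t u
    have h2 := hle w z u t
    rw [dist_comm w z, norm_sub_rev (φ u)] at h2
    exact abs_le.2 ⟨by linarith, by linarith⟩
  have hcont : Continuous g := by
    rw [continuous_iff_continuousAt]
    rintro ⟨z, t⟩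
    rw [ContinuousAt, tendsto_iff_dist_tendsto_zero]
    have hb : Continuous fun w : Z × T => N * dist w.1 z + ‖φ w.2 - φ t‖ := by fun_prop
    have h0 := hb.tendsto (z, t)
    simp only [dist_self, sub_self, norm_zero, mul_zero, add_zero] at h0
    exact squeeze_zero (fun _ => dist_nonneg) (fun w => habs w.1 z w.2 t) h0
  refine ⟨⟨g, hcont⟩, fun x t => le_antisymm ?_ (le_ciInf fun y => ?_), fun t z w => ?_⟩
  · exact (ciInf_le (hbdd (i x) t) x).trans (by simp)
  · have := (abs_le.1 (hf t x y)).2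
    simp only
    linarith
  · simpa using habs z w t t

/-- Lipschitz extension into a finite-dimensional space with a constant that depends only on the
space. -/
theorem exists_lipschitz_extension_const (E : Type*) [NormedAddCommGroup E] [NormedSpace ℝ E]
    [FiniteDimensional ℝ E] :
    ∃ C : ℝ≥0, ∀ (X Z T : Type) [MetricSpace Z] [TopologicalSpace X]
      [CompactSpace X] [TopologicalSpace T] (i : X → Z) (f : C(X × T, E)) (N : ℝ), 0 ≤ N →
      (∀ t x y, ‖f (x, t) - f (y, t)‖ ≤ N * dist (i x) (i y)) →
      ∃ g : C(Z × T, E), (∀ x t, g (i x, t) = f (x, t)) ∧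
        ∀ t z w, ‖g (z, t) - g (w, t)‖ ≤ C * N * dist z w := by
  let b := Module.finBasis ℝ E
  let l := fun j => LinearMap.toContinuousLinearMap (b.coord j)
  refine ⟨∑ j, ‖l j‖₊ * ‖b j‖₊, ?_⟩
  intro X Z T _ _ _ _ i f N hN hf
  have hl : ∀ j t x y, |l j (f (x, t)) - l j (f (y, t))| ≤ (‖l j‖ * N) * dist (i x) (i y) := by
    intro j t x y
    rw [← map_sub, ← Real.norm_eq_abs, mul_assoc]
    exact ((l j).le_opNorm _).trans (mul_le_mul_of_nonneg_left (hf t x y) (norm_nonneg _))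
  choose g hg1 hg2 using fun j => exists_jointly_lipschitz_extension i
    ((l j : C(E, ℝ)).comp f) (mul_nonneg (norm_nonneg (l j)) hN) (hl j)
  refine ⟨⟨fun z => ∑ j, g j z • b j, by fun_prop⟩, fun x t => ?_, fun t z w => ?_⟩
  · simp only [ContinuousMap.coe_mk, hg1]
    exact b.sum_repr (f (x, t))
  · simp only [ContinuousMap.coe_mk, ← Finset.sum_sub_distrib, ← sub_smul]
    push_cast
    rw [Finset.sum_mul, Finset.sum_mul]
    refine (norm_sum_le _ _).trans (Finset.sum_le_sum fun j _ => ?_)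
    rw [norm_smul, Real.norm_eq_abs]
    refine (mul_le_mul_of_nonneg_right (hg2 j t z w) (norm_nonneg _)).trans_eq ?_
    ring

/-- Without it the infimum defining `λ_n` could be over the empty set, with default value `0`.
Extend coordinatewise, take self-adjoint parts, then retract onto the ball of radius `‖F‖`; the
retraction costs the factor `2`. -/
theorem exists_isExtensionConstant (n : ℕ) : ∃ c, IsExtensionConstant n c := by
  obtain ⟨C, hC⟩ := exists_lipschitz_extension_const (Mat n)
  refine ⟨2 * C, ?_⟩
  intro Z _ _ X _ T _ _ F N hsa hL
  obtain ⟨g, hg1, hg2⟩ := hC X Z T ((↑) : X → Z) F N N.2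
    (fun t x y => lipSeminorm_le_coe_iff.1 (hL t) x y)
  let h : Z × T → Mat n := fun z => (1 / 2 : ℝ) • (g z + star (g z))
  have hh : Continuous h := by fun_prop
  have hhF : ∀ (x : X) t, h (x, t) = F (x, t) := fun x t => by
    simp only [h, hg1, (hsa (x, t)).star_eq]
    rw [← two_smul ℝ, smul_smul]
    norm_num
  have hhL : ∀ t z w, ‖h (z, t) - h (w, t)‖ ≤ C * N * dist z w := fun t z w => by
    have e : h (z, t) - h (w, t) =
        (1 / 2 : ℝ) • ((g (z, t) - g (w, t)) + star (g (z, t) - g (w, t))) := by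
      simp only [h, ← smul_sub, star_sub]
      congr 1
      abel
    rw [e, norm_smul, Real.norm_of_nonneg (by norm_num)]
    have h1 := norm_add_le (g (z, t) - g (w, t)) (star (g (z, t) - g (w, t)))
    rw [norm_star] at h1
    linarith [hg2 t z w]
  have hrr : Continuous (radialRetraction ‖F‖ : Mat n → Mat n) :=
    (LipschitzWith.of_dist_le_mul (K := 2) fun a b => by
      simpa [dist_eq_norm] using norm_radialRetraction_sub_le (norm_nonneg F) a b).continuous
  let G : C(Z × T, Mat n) := ⟨fun z => radialRetraction ‖F‖ (h z), hrr.comp hh⟩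
  have hGF : ∀ (x : X) t, G (x, t) = F (x, t) := fun x t => by
    simp only [G, ContinuousMap.coe_mk, hhF]
    exact radialRetraction_of_norm_le (F.norm_coe_le_norm _)
  refine ⟨G, fun z => ?_, hGF, fun t => ?_, le_antisymm ?_ ?_⟩
  · refine IsSelfAdjoint.smul (IsSelfAdjoint.all _) (IsSelfAdjoint.smul (IsSelfAdjoint.all _) ?_)
    exact IsSelfAdjoint.add_star_self _
  · refine lipSeminorm_le_coe_iff.2 fun z w => ?_
    refine (norm_radialRetraction_sub_le (norm_nonneg F) _ _).trans ?_
    push_cast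
    linarith [hhL t z w]
  · exact (ContinuousMap.norm_le _ (norm_nonneg F)).2 fun z =>
      norm_radialRetraction_le (norm_nonneg F) _
  · refine (ContinuousMap.norm_le _ (norm_nonneg G)).2 fun z => ?_
    have := G.norm_coe_le_norm ((z.1 : Z), z.2)
    rwa [hGF] at this

theorem one_le_extLambda {n : ℕ} (hn : 0 < n) : 1 ≤ extLambda n :=
  le_csInf (exists_isExtensionConstant n) fun _ hc => hc.one_le hn

theorem exists_isExtensionConstant_lt {n : ℕ} {a : ℝ} (ha : extLambda n < a) :
    ∃ c, IsExtensionConstant n c ∧ (c : ℝ) < a := by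
  have h : extLambda n < a.toNNReal := by
    rwa [← NNReal.coe_lt_coe, Real.coe_toNNReal a ((NNReal.coe_nonneg _).trans ha.le)]
  obtain ⟨c, hc, hca⟩ := exists_lt_of_csInf_lt (exists_isExtensionConstant n) h
  exact ⟨c, hc, Real.lt_toNNReal_iff_coe_lt.1 hca⟩

/-! ### Extending paths of projections. -/

/-- An extension constant works for compact metric spaces in any universe. -/
theorem IsExtensionConstant.exists_extension {n : ℕ} {c : ℝ≥0} (hc : IsExtensionConstant n c)
    {X Z : Type*} [MetricSpace X] [CompactSpace X] [MetricSpace Z] [CompactSpace Z]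
    {T : Type} [TopologicalSpace T] [CompactSpace T] {i : X → Z} (hi : Isometry i)
    (F : C(X × T, Mat n)) (N : ℝ≥0) (hsa : ∀ z, IsSelfAdjoint (F z))
    (hF : ∀ t x y, ‖F (x, t) - F (y, t)‖ ≤ N * dist x y) :
    ∃ G : C(Z × T, Mat n), (∀ z, IsSelfAdjoint (G z)) ∧ (∀ x t, G (i x, t) = F (x, t)) ∧
      (∀ t z w, ‖G (z, t) - G (w, t)‖ ≤ c * N * dist z w) ∧ ‖G‖ = ‖F‖ := by
  -- The Kuratowski embedding into bounded sequences gives an isometric copy of `Z` in `Type`.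
  let e := (kuratowskiEmbedding.isometry Z).isometryEquivOnRange
  have hei : Isometry (e ∘ i) := e.isometry.comp hi
  let k := hei.isometryEquivOnRange
  have : CompactSpace (Set.range (kuratowskiEmbedding Z)) :=
    isCompact_iff_compactSpace.1
      (isCompact_range (kuratowskiEmbedding.isometry Z).continuous)
  have : CompactSpace (Set.range (e ∘ i)) :=
    isCompact_iff_compactSpace.1 (isCompact_range hei.continuous)
  have hk : ∀ x, ((k x : Set.range (e ∘ i)) : Set.range (kuratowskiEmbedding Z)) = e (i x) :=
    fun x => rfl
  obtain ⟨G, hG1, hG2, hG3, hG4⟩ := hc _ (Set.range (e ∘ i)) T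
    ⟨fun z => F (k.symm z.1, z.2), by have := k.symm.continuous; fun_prop⟩ N
    (fun z => hsa _) (fun t => lipSeminorm_le_coe_iff.2 fun x y => by
      have := hF t (k.symm x) (k.symm y)
      rwa [k.symm.dist_eq] at this)
  have hGF : ∀ x t, G (e (i x), t) = F (x, t) := fun x t => by
    rw [← hk, hG2]
    simp
  refine ⟨⟨fun z => G (e z.1, z.2), by have := e.continuous; fun_prop⟩, fun z => hG1 _, hGF,
    fun t z w => ?_, le_antisymm ?_ ?_⟩
  · have := lipSeminorm_le_coe_iff.1 (hG3 t) (e z) (e w)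
    rw [e.dist_eq] at this
    simpa using this
  · refine (ContinuousMap.norm_le _ (norm_nonneg F)).2 fun z => (G.norm_coe_le_norm _).trans ?_
    rw [hG4]
    exact (ContinuousMap.norm_le _ (norm_nonneg F)).2 fun z => F.norm_coe_le_norm _
  · refine (ContinuousMap.norm_le _ (norm_nonneg _)).2 fun z => ?_
    have := ContinuousMap.norm_coe_le_norm
      (⟨fun z => G (e z.1, z.2), by have := e.continuous; fun_prop⟩ : C(Z × T, Mat n)) (i z.1, z.2)
    simp only [ContinuousMap.coe_mk, hGF] at this
    exact this


/-- A path of Lipschitz projections extends to any compact metric space in which the original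
space is sufficiently dense. -/
theorem IsExtensionConstant.exists_projection_extension {n : ℕ} {c : ℝ≥0}
    (hc : IsExtensionConstant n c) {X Z : Type*} [MetricSpace X] [CompactSpace X] [MetricSpace Z]
    [CompactSpace Z] {T : Type} [TopologicalSpace T] [CompactSpace T] {i : X → Z}
    (hi : Isometry i) (p : C(T, C(X, Mat n))) (hp : ∀ t, IsStarProjection (p t)) {R : ℝ≥0}
    (hpR : ∀ t x y, ‖p t x - p t y‖ ≤ R * dist x y) {ε : ℝ} (hε : 0 ≤ ε)
    (hdense : ∀ z, ∃ x, dist z (i x) ≤ ε) (hsmall : ε * (c * R) ≤ 1 / 12) :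
    ∃ P : C(Z × T, Mat n), (∀ z, IsStarProjection (P z)) ∧ (∀ x t, P (i x, t) = p t x) ∧
      ∀ t z w, ‖P (z, t) - P (w, t)‖ ≤ c * R / (1 - 8 * (ε * (c * R))) * dist z w := by
  have hpx : ∀ t x, IsStarProjection (p t x) := fun t x =>
    ⟨congrArg (fun f : C(X, Mat n) => f x) (hp t).isIdempotentElem.eq,
      congrArg (fun f : C(X, Mat n) => f x) (hp t).isSelfAdjoint.star_eq⟩
  let F : C(X × T, Mat n) := p.uncurry.comp ContinuousMap.prodSwap
  have hFp : ∀ x t, F (x, t) = p t x := fun x t => rfl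
  obtain ⟨G, hG1, hG2, hG3, hG4⟩ := hc.exists_extension hi F R
    (fun z => (hpx z.2 z.1).isSelfAdjoint) hpR
  have hF1 : ‖F‖ ≤ 1 := (ContinuousMap.norm_le _ zero_le_one).2 fun z => (hpx z.2 z.1).norm_le
  have hGn : ∀ z, ‖G z‖ ≤ 1 := fun z => (G.norm_coe_le_norm z).trans (hG4.trans_le hF1)
  set δ : ℝ := ε * (c * R)
  have hδ0 : 0 ≤ δ := by positivity
  have hgap : 2 * (4 * δ) < 1 := by linarith
  have hex : ∀ z, ∃ e, IsNearSpectralProjection (4 * δ) (G z) e := by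
    rintro ⟨z, t⟩
    obtain ⟨x, hx⟩ := hdense z
    refine (hG1 _).exists_isNearSpectralProjection (hGn _) (hpx t x) hsmall ?_
    rw [← hFp, ← hG2]
    refine (hG3 t z (i x)).trans ?_
    rw [show δ = c * R * ε from mul_comm _ _]
    gcongr
  -- The choices are made independently at each point; `hPl` makes them fit together continuously.
  choose P hP using hex
  have hPl : ∀ z w, ‖P z - P w‖ ≤ ‖G z - G w‖ / (1 - 8 * δ) := fun z w => by
    have := (hP z).norm_sub_le hgap (hP w)
    rwa [← mul_assoc, show (2 : ℝ) * 4 = 8 by norm_num] at this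
  have hPc : Continuous P := by
    rw [continuous_iff_continuousAt]
    intro z
    rw [ContinuousAt, tendsto_iff_norm_sub_tendsto_zero]
    have hb : Continuous fun w => ‖G w - G z‖ / (1 - 8 * δ) := by fun_prop
    have h0 := hb.tendsto z
    simp only [sub_self, norm_zero, zero_div] at h0
    exact squeeze_zero (fun _ => norm_nonneg _) (fun w => hPl w z) h0
  refine ⟨⟨P, hPc⟩, fun z => (hP z).isStarProjection, fun x t => ?_, fun t z w => ?_⟩
  -- Over `X` the value of `G` is already a projection, and two near spectral projections of the
  -- same element coincide.
  · have h := hP (i x, t)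
    rw [hG2, hFp] at h
    have := h.norm_sub_le hgap ((hpx t x).isNearSpectralProjection_self (by positivity))
    rw [sub_self, norm_zero, zero_div, norm_le_zero_iff, sub_eq_zero] at this
    exact this
  · refine (hPl _ _).trans ?_
    rw [div_mul_eq_mul_div]
    have := hG3 t z w
    gcongr
    linarith

/-! ### Comparison of the constants and the theorem. -/

theorem exists_projection_path_of_hausdorffDist_lt {X Y Z : Type*} [MetricSpace X]
    [CompactSpace X] [Nonempty X] [MetricSpace Y] [CompactSpace Y] [Nonempty Y] [MetricSpace Z]
    {i : X → Z} {j : Y → Z} (hi : Isometry i) (hj : Isometry j)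
    (hij : Set.range i ∪ Set.range j = Set.univ) {n : ℕ} (hn : 0 < n) {r ε s : ℝ} (hr : 0 < r)
    (hεr : ε * extLambda n * r < 1 / 12)
    (hdist : Metric.hausdorffDist (Set.range i) (Set.range j) < ε)
    (hs : s = extLambda n * r * (1 - 12 * ε * extLambda n * r)⁻¹)
    (p : C(unitInterval, lipProjectionsLT n r X)) :
    ∃ q : C(unitInterval, C(Y, Mat n)), ∀ t, IsStarProjection (q t) ∧
      ∃ a : Z → Mat n, (∀ x, a (i x) = (p t).1 x) ∧ (∀ y, a (j y) = q t y) ∧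
        lipSeminorm a < ENNReal.ofReal s := by
  have hiK := isCompact_range hi.continuous
  have hjK := isCompact_range hj.continuous
  have : CompactSpace Z := ⟨hij ▸ hiK.union hjK⟩
  obtain ⟨ε', hε', hε'ε⟩ := exists_between hdist
  have hε'0 : 0 < ε' := Metric.hausdorffDist_nonneg.trans_lt hε'
  have hdense : ∀ z, ∃ x, dist z (i x) ≤ ε' := by
    intro z
    rcases hij ▸ Set.mem_univ z with ⟨x, rfl⟩ | hz
    · exact ⟨x, by simpa using hε'0.le⟩
    · obtain ⟨_, ⟨x, rfl⟩, hx⟩ := Metric.exists_dist_lt_of_hausdorffDist_lt' hz hε'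
        (Metric.hausdorffEDist_ne_top_of_nonempty_of_bounded (Set.range_nonempty _)
          (Set.range_nonempty _) hiK.isBounded hjK.isBounded)
      exact ⟨x, by rw [dist_comm]; exact hx.le⟩
  have hl : (1 : ℝ) ≤ extLambda n := by exact_mod_cast one_le_extLambda hn
  set l : ℝ := ((extLambda n : ℝ≥0) : ℝ)
  have hlr : 0 < l * r := by positivity
  have hgap : 0 < 1 - 12 * ε * l * r := by linarith
  have hstep : 0 < (ε - ε') * (l * r) := mul_pos (sub_pos.2 hε'ε) hlr
  have hstep' : 0 < ε' * (l * r) := mul_pos hε'0 hlr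
  have hA : 0 < 1 - 12 * ((ε - ε') * (l * r)) := by linarith
  -- The infimum `l` need not be attained; the slack `ε - ε'` pays for `c > l`. The threshold for
  -- `c` is the solution of `c / (1 - 12 ε' c r) = l / (1 - 12 ε l r)`.
  obtain ⟨c, hc, hcl⟩ := exists_isExtensionConstant_lt (n := n)
    (a := l / (1 - 12 * ((ε - ε') * (l * r)))) (by
      rw [lt_div_iff₀ hA]
      change l * _ < l
      nlinarith)
  rw [lt_div_iff₀ hA] at hcl
  have hkey : (c : ℝ) * (1 - 12 * ε * l * r) < l * (1 - 12 * (ε' * (c * r))) := by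
    linarith
  have hsmall : 0 < 1 - 12 * (ε' * (c * r)) := by
    refine pos_of_mul_pos_right ((mul_nonneg c.2 hgap.le).trans_lt hkey) (by positivity)
  have hcr : 0 ≤ ε' * (c * r) := by positivity
  have hsK : c * r / (1 - 8 * (ε' * (c * r))) < s := by
    rw [hs, ← div_eq_mul_inv]
    -- The construction gives `8`; weakening it to `12` matches the form of `s`.
    calc c * r / (1 - 8 * (ε' * (c * r))) ≤ c * r / (1 - 12 * (ε' * (c * r))) := by
          gcongr
          norm_num
      _ < l * r / (1 - 12 * ε * l * r) := by
          rw [div_lt_div_iff₀ hsmall hgap]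
          linarith [mul_lt_mul_of_pos_right hkey hr]
  have hK0 : 0 ≤ c * r / (1 - 8 * (ε' * (c * r))) := div_nonneg (by positivity) (by linarith)
  have hR : (r.toNNReal : ℝ) = r := Real.coe_toNNReal r hr.le
  obtain ⟨P, hP1, hP2, hP3⟩ := hc.exists_projection_extension hi
    ⟨fun t => (p t).1, by fun_prop⟩ (fun t => (p t).2.1.1) (R := r.toNNReal)
    (fun t => by rw [hR]; exact (lipSeminorm_le_ofReal_iff hr.le).1 (p t).2.2.le) hε'0.le hdense
    (by rw [hR]; linarith)
  rw [hR] at hP3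
  refine ⟨ContinuousMap.curry ⟨fun z => P (j z.2, z.1), by have := hj.continuous; fun_prop⟩,
    fun t => ⟨⟨?_, ?_⟩, fun z => P (z, t), fun x => hP2 x t, fun y => rfl, ?_⟩⟩
  · exact ContinuousMap.ext fun y => (hP1 (j y, t)).isIdempotentElem.eq
  · exact ContinuousMap.ext fun y => (hP1 (j y, t)).isSelfAdjoint.star_eq
  · refine ((lipSeminorm_le_ofReal_iff hK0).2 (hP3 t)).trans_lt ?_
    exact (ENNReal.ofReal_lt_ofReal_iff_of_nonneg hK0).2 hsK

theorem lipSeminorm_comp_le_of_isometry {Y Z : Type*} [MetricSpace Y] [MetricSpace Z] {n : ℕ}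
    {j : Y → Z} (hj : Isometry j) (a : Z → Mat n) : lipSeminorm (a ∘ j) ≤ lipSeminorm a := by
  simp only [lipSeminorm, iSup_le_iff, Function.comp_apply]
  intro x y hxy
  rw [← hj.dist_eq]
  exact le_iSup₂_of_le (j x) (j y) (le_iSup_of_le (hj.injective.ne hxy) le_rfl)

/-- `X` and `Y` are compact metric spaces, and the instance `ρ` is a metric on their disjoint union
that restricts to the given metrics on `X` and `Y`. A path is a continuous map on `[0, 1]`, and
`p t ⊕ q t` is the function on the disjoint union given by `p t` on `X` and `q t` on `Y`. -/
theorem theorem6p6 {X Y : Type*} [MetricSpace X] [CompactSpace X] [Nonempty X]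
    [MetricSpace Y] [CompactSpace Y] [Nonempty Y] [ρ : MetricSpace (X ⊕ Y)]
    (hX : Isometry (Sum.inl : X → X ⊕ Y)) (hY : Isometry (Sum.inr : Y → X ⊕ Y))
    (n : ℕ) (hn : 0 < n) (r ε s : ℝ) (hr : 0 < r)
    (hεr : ε * extLambda n * r < 1 / 12)
    (hdist : Metric.hausdorffDist (Set.range (Sum.inl : X → X ⊕ Y))
      (Set.range (Sum.inr : Y → X ⊕ Y)) < ε)
    (hs : s = extLambda n * r * (1 - 12 * ε * extLambda n * r)⁻¹)
    (p : C(unitInterval, lipProjectionsLT n r X)) :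
    ∃ q : C(unitInterval, lipProjectionsLT n s Y),
      ∀ t, lipSeminorm (Sum.elim (p t).1 (q t).1) < ENNReal.ofReal s := by
  obtain ⟨q, hq⟩ := exists_projection_path_of_hausdorffDist_lt hX hY
    Set.range_inl_union_range_inr hn hr hεr hdist hs p
  have helim : ∀ t, lipSeminorm (Sum.elim (p t).1 (q t)) < ENNReal.ofReal s := by
    intro t
    obtain ⟨-, a, hap, haq, ha⟩ := hq t
    have e : Sum.elim (p t).1 (q t) = a :=
      funext fun z => z.casesOn (fun x => (hap x).symm) (fun y => (haq y).symm)
    rwa [e]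
  have hqs : ∀ t, lipSeminorm (q t : Y → Mat n) < ENNReal.ofReal s := fun t =>
    (lipSeminorm_comp_le_of_isometry hY (Sum.elim (p t).1 (q t))).trans_lt (helim t)
  exact ⟨⟨fun t => ⟨q t, ⟨(hq t).1, (hqs t).trans ENNReal.ofReal_lt_top⟩, hqs t⟩, by fun_prop⟩,
    helim⟩
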